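/- There is an absolute constant $C>0$ with the following property. Let $m,n,N\ge 1$, let $f(x,y)=\frac1N\sum_{i=1}^N f_i(x,y)$ with $f_i:\mathbb{R}^m\times\mathbb{R}^n\to\mathbb{R}$ twice differentiable, and let $\mu>0$ and $L_0,L_1$ be such that for every $i$: $f_i$ is $L_1$-smooth (its full gradient is $L_1$-Lipschitz for the Euclidean norm on $\mathbb{R}^{m+n}$), $f_i(\cdot,y)$ is $L_0$-Lipschitz for every $y$, and $f_i(x,\cdot)$ is $\mu$-strongly concave for every $x$. Put $\kappa=L_1/\mu$. Write $\nabla_1 f,\nabla_2 f$ for the partial gradients, $\nabla_{k\ell}f$ ($k,\ell\in\{1,2\}$) for the Jacobian of $\nabla_k f$ in the $\ell$-th argument, and $G=\nabla_{11}f-\nabla_{12}f\,(\nabla_{22}f)^{-1}\nabla_{21}f$. Fix a point $(x,y)$, $0<\epsilon_1\le 2L_0$, $0<\epsilon_2\le 4L_1$ and $0<\delta<1$, and assume that $m\ge 2$ or $\delta\le\frac12$. Let $B_1,B_{11},B_{12},B_{21},B_{22}$ be mini-batches, each consisting of indices drawn independently and uniformly from $\{1,\dots,N\}$ (sampling with replacement),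 with sizes $$|B_1|\ge C\,\frac{L_0^2}{\epsilon_1^2}\ln\frac{m}{\delta},\qquad |B_{k\ell}|\ge C\,\frac{L_1^2}{\epsilon_2^2}\ln\frac{m+n}{\delta}\quad (k,\ell\in\{1,2\}).$$ Let $\widehat\nabla_1 f=\frac1{|B_1|}\sum_{i\in B_1}\nabla_1 f_i$, $\widehat\nabla_{k\ell}f=\frac1{|B_{k\ell}|}\sum_{i\in B_{k\ell}}\nabla_{k\ell}f_i$ (repeated indices are counted with multiplicity) and $\widehat G=\widehat\nabla_{11}f-\widehat\nabla_{12}f\,(\widehat\nabla_{22}f)^{-1}\widehat\nabla_{21}f$. Then $\nabla_{22}f(x,y)$ is invertible and, with probability at least $1-\delta$, $\widehat\nabla_{22}f(x,y)$ is invertible and all of the following hold (Euclidean norm for vectors, spectral norm for matrices): $$\|\widehat\nabla_1 f(x,y)-\nabla_1 f(x,y)\|\le\epsilon_1,\qquad \|\widehat\nabla_{k\ell}f(x,y)-\nabla_{k\ell}f(x,y)\|\le\epsilon_2\ \ \forall k,\ell\in\{1,2\},\qquad \|\widehat G(x,y)-G(x,y)\|\le(\kappa+1)^2\epsilon_2.$$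 -/

import Mathlib

open MeasureTheory ProbabilityTheory

noncomputable section

namespace SubsampledMinimax

/-- `ℝᵈ` with its Euclidean norm. -/
abbrev Vec (d : ℕ) : Type := EuclideanSpace ℝ (Fin d)

/-- The space `ℝᵐ × ℝⁿ` of pairs with the Euclidean norm `‖(x, y)‖² = ‖x‖² + ‖y‖²`. -/
abbrev Pair (m n : ℕ) : Type := WithLp 2 (Vec m × Vec n)

variable {m n N : ℕ}

/-- A bivariate function `f(x, y)`, seen as a function of the pair `z = (x, y)`. -/
def joint (f : Vec m → Vec n → ℝ) : Pair m n → ℝ := fun z => f z.fst z.snd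

/-- `f` is twice (Fréchet) differentiable, jointly in both arguments. -/
def TwiceDifferentiable (f : Vec m → Vec n → ℝ) : Prop :=
  Differentiable ℝ (joint f) ∧ Differentiable ℝ (gradient (joint f))

/-- `f` is `L`-smooth: differentiable, with an `L`-Lipschitz full gradient. -/
def IsSmooth (L : ℝ) (f : Vec m → Vec n → ℝ) : Prop :=
  Differentiable ℝ (joint f) ∧
    ∀ z w : Pair m n, ‖gradient (joint f) z - gradient (joint f) w‖ ≤ L * ‖z - w‖

/-- The assumptions on one sample function: twice differentiable, `L₁`-smooth,
`L₀`-Lipschitz in `x` for each `y`, and `μ`-strongly concave in `y` for each `x`. -/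
structure SampleAssumption (L₀ L₁ μ : ℝ) (f : Vec m → Vec n → ℝ) : Prop where
  twiceDifferentiable : TwiceDifferentiable f
  smooth : IsSmooth L₁ f
  lipschitz : ∀ (y : Vec n) (x x' : Vec m), |f x y - f x' y| ≤ L₀ * ‖x - x'‖
  strongConcave : ∀ x : Vec m, StrongConcaveOn Set.univ μ (fun y => f x y)

/-- Partial gradient `∇₁ f(x, y)`. -/
def grad₁ (f : Vec m → Vec n → ℝ) (x : Vec m) (y : Vec n) : Vec m :=
  gradient (fun x' => f x' y) x

/-- Partial gradient `∇₂ f(x, y)`. -/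
def grad₂ (f : Vec m → Vec n → ℝ) (x : Vec m) (y : Vec n) : Vec n :=
  gradient (fun y' => f x y') y

/-! The Jacobian blocks `∇ₖₗ f` (derivative of `∇ₖ f` in the `l`-th argument), as linear maps;
their operator norm is the spectral norm. -/

/-- `∇₁₁ f(x, y)`. -/
def jac₁₁ (f : Vec m → Vec n → ℝ) (x : Vec m) (y : Vec n) : Vec m →L[ℝ] Vec m :=
  fderiv ℝ (fun x' => grad₁ f x' y) x

/-- `∇₁₂ f(x, y)`. -/
def jac₁₂ (f : Vec m → Vec n → ℝ) (x : Vec m) (y : Vec n) : Vec n →L[ℝ] Vec m :=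
  fderiv ℝ (fun y' => grad₁ f x y') y

/-- `∇₂₁ f(x, y)`. -/
def jac₂₁ (f : Vec m → Vec n → ℝ) (x : Vec m) (y : Vec n) : Vec m →L[ℝ] Vec n :=
  fderiv ℝ (fun x' => grad₂ f x' y) x

/-- `∇₂₂ f(x, y)`. -/
def jac₂₂ (f : Vec m → Vec n → ℝ) (x : Vec m) (y : Vec n) : Vec n →L[ℝ] Vec n :=
  fderiv ℝ (fun y' => grad₂ f x y') y

/-- The Schur complement `A₁₁ - A₁₂ A₂₂⁻¹ A₂₁`. -/
def schur (A₁₁ : Vec m →L[ℝ] Vec m) (A₁₂ : Vec n →L[ℝ] Vec m) (A₂₁ : Vec m →L[ℝ] Vec n)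
    (A₂₂ : Vec n →L[ℝ] Vec n) : Vec m →L[ℝ] Vec m :=
  A₁₁ - A₁₂ ∘L A₂₂.inverse ∘L A₂₁

/-- `G(x, y) = [∇₁₁ f - ∇₁₂ f (∇₂₂ f)⁻¹ ∇₂₁ f](x, y)`. -/
def schurG (f : Vec m → Vec n → ℝ) (x : Vec m) (y : Vec n) : Vec m →L[ℝ] Vec m :=
  schur (jac₁₁ f x y) (jac₁₂ f x y) (jac₂₁ f x y) (jac₂₂ f x y)

/-- The finite-sum objective `f = (1/N) ∑ᵢ fᵢ`. -/
def average (f : Fin N → Vec m → Vec n → ℝ) (x : Vec m) (y : Vec n) : ℝ :=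
  (1 / (N : ℝ)) * ∑ i, f i x y

/-- The mini-batch mean `(1/|B|) ∑_{i ∈ B} vᵢ`; a batch sampled with replacement is a finite
sequence of indices, counted with repetition. -/
def batchMean {V : Type*} [AddCommGroup V] [Module ℝ V] {b : ℕ} (B : Fin b → Fin N)
    (v : Fin N → V) : V :=
  (1 / (b : ℝ)) • ∑ k, v (B k)

/-- Uniform sampling with replacement: the `b` random indices `B 0, …, B (b - 1)` are independent
and each of them is uniform on the `N` samples. -/
structure IsUniformBatch {Ω : Type*} [MeasurableSpace Ω] (P : Measure Ω) {b : ℕ}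
    (B : Fin b → Ω → Fin N) : Prop where
  measurable : ∀ k, Measurable (B k)
  indep : iIndepFun B P
  uniform : ∀ k j, P.real {ω | B k ω = j} = 1 / (N : ℝ)

end SubsampledMinimax

end

noncomputable section

namespace SubsampledMinimax

/-! ### Trace inequalities for powers of symmetric operators -/

section Trace

variable {E : Type*} [NormedAddCommGroup E] [InnerProductSpace ℝ E] [FiniteDimensional ℝ E]

/-! The probabilistic core is a matrix Khintchine-type moment bound proved by exchangeable pairs.
For a sum `S` of `b` sampled, centered, symmetric operators of norm at most `R`, resampling one
index gives an exchangeable copy of `S`. A mean value inequality for traces then yields E tr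
S^(2p+2) ≤ 2(2p+1)bR² E tr S^(2p) (`traceMoment_succ_le`). Iterating, and applying Markov's
inequality with p of order log(D/δ), gives a tail bound whose dependence on dimension is logarithmic
(`IsUniformBatch.measureReal_batchMean_large_le`). The self-adjoint dilation reduces rectangular
blocks to the symmetric case, and gradients are treated as functionals. All expectations are finite
sums over index sequences, since a uniform batch has the uniform law on them.

The rest is deterministic. Smoothness and the Lipschitz condition bound the sampled blocks and
gradients. Strong concavity gives ⟨∇₂₂fᵢ v, v⟩ ≤ -μ‖v‖², which survives averaging over any nonempty
batch, so the sampled block is always invertible with inverse of norm at most 1/μ. When the four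
blocks are ε₂-accurate, telescoping the Schur complement gives the factor 1 + 2κ + κ²
(`norm_schur_sub_schur_le`). A union bound over five events concludes. -/

theorem pow_apply_eigenvectorBasis {T : E →ₗ[ℝ] E} (hT : T.IsSymmetric) {d : ℕ}
    (hd : Module.finrank ℝ E = d) (k : ℕ) (i : Fin d) :
    (T ^ k) (hT.eigenvectorBasis hd i) = hT.eigenvalues hd i ^ k • hT.eigenvectorBasis hd i := by
  induction k with
  | zero => simp
  | succ k ih =>
    rw [pow_succ', Module.End.mul_apply, ih, map_smul, hT.apply_eigenvectorBasis, smul_smul, pow_succ]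
    rfl

theorem inner_pow_eq_sum {T : E →ₗ[ℝ] E} (hT : T.IsSymmetric) {d : ℕ}
    (hd : Module.finrank ℝ E = d) (k : ℕ) (v : E) :
    inner ℝ v ((T ^ k) v) =
      ∑ i, hT.eigenvalues hd i ^ k * inner ℝ (hT.eigenvectorBasis hd i) v ^ 2 := by
  set u := hT.eigenvectorBasis hd
  conv_lhs => rw [← u.sum_repr' v, map_sum]
  simp_rw [map_smul, u, pow_apply_eigenvectorBasis hT hd, inner_sum, inner_smul_right]
  refine Finset.sum_congr rfl fun i _ => ?_
  rw [sum_inner]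
  simp_rw [inner_smul_left, orthonormal_iff_ite.1 (hT.eigenvectorBasis hd).orthonormal]
  simp
  ring

theorem trace_pow_eq_sum {T : E →ₗ[ℝ] E} (hT : T.IsSymmetric) {d : ℕ}
    (hd : Module.finrank ℝ E = d) (k : ℕ) :
    LinearMap.trace ℝ E (T ^ k) = ∑ i, hT.eigenvalues hd i ^ k := by
  rw [LinearMap.trace_eq_sum_inner _ (hT.eigenvectorBasis hd)]
  simp_rw [pow_apply_eigenvectorBasis hT hd, inner_smul_right]
  simp

/-- Diagonalizing `X` and `Y` in their own eigenbases leaves nonnegative weights, so scalar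
inequalities between eigenvalues transfer to traces although `X` and `Y` need not commute. -/
theorem trace_mul_pow_mul_pow_eq_sum {D X Y : E →ₗ[ℝ] E} (hD : D.IsSymmetric)
    (hX : X.IsSymmetric) (hY : Y.IsSymmetric) {d : ℕ} (hd : Module.finrank ℝ E = d) (k l : ℕ) :
    LinearMap.trace ℝ E (D * (X ^ k * (D * Y ^ l))) =
      ∑ j, ∑ i, hX.eigenvalues hd i ^ k * hY.eigenvalues hd j ^ l *
        inner ℝ (hX.eigenvectorBasis hd i) (D (hY.eigenvectorBasis hd j)) ^ 2 := by
  rw [LinearMap.trace_eq_sum_inner _ (hY.eigenvectorBasis hd)]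
  refine Finset.sum_congr rfl fun j _ => ?_
  simp only [Module.End.mul_apply, pow_apply_eigenvectorBasis hY hd, map_smul, inner_smul_right]
  rw [← hD, inner_pow_eq_sum hX hd, Finset.mul_sum]
  exact Finset.sum_congr rfl fun i _ => by ring

/-- Pairing `k` with `2q - k`, each pair is at most `x^(2q) + y^(2q)` by rearrangement, as both
powers are monotone in the absolute value. -/
theorem sum_pow_mul_pow_le (x y : ℝ) (q : ℕ) :
    ∑ k ∈ Finset.range (2 * q + 1), x ^ k * y ^ (2 * q - k) ≤
      (2 * q + 1) / 2 * (x ^ (2 * q) + y ^ (2 * q)) := by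
  have key : ∀ k ∈ Finset.range (2 * q + 1),
      x ^ k * y ^ (2 * q - k) + x ^ (2 * q - k) * y ^ k ≤ x ^ (2 * q) + y ^ (2 * q) := by
    intro k hk
    have hk' : k + (2 * q - k) = 2 * q := by have := Finset.mem_range.1 hk; omega
    set l := 2 * q - k
    have e : ∀ z : ℝ, z ^ (2 * q) = |z| ^ k * |z| ^ l := fun z => by
      rw [← pow_add, hk', (even_two_mul q).pow_abs]
    have h1 : x ^ k * y ^ l ≤ |x| ^ k * |y| ^ l := by
      rw [← abs_pow, ← abs_pow, ← abs_mul]; exact le_abs_self _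
    have h2 : x ^ l * y ^ k ≤ |x| ^ l * |y| ^ k := by
      rw [← abs_pow, ← abs_pow, ← abs_mul]; exact le_abs_self _
    have h3 : 0 ≤ (|x| ^ k - |y| ^ k) * (|x| ^ l - |y| ^ l) := by
      rcases le_total |x| |y| with h | h
      · exact mul_nonneg_of_nonpos_of_nonpos
          (sub_nonpos.2 (pow_le_pow_left₀ (abs_nonneg _) h _))
          (sub_nonpos.2 (pow_le_pow_left₀ (abs_nonneg _) h _))
      · exact mul_nonneg
          (sub_nonneg.2 (pow_le_pow_left₀ (abs_nonneg _) h _))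
          (sub_nonneg.2 (pow_le_pow_left₀ (abs_nonneg _) h _))
    rw [e x, e y]
    nlinarith
  have hsum := Finset.sum_le_sum key
  rw [Finset.sum_add_distrib, Finset.sum_const, Finset.card_range, nsmul_eq_mul] at hsum
  have hrefl : ∑ k ∈ Finset.range (2 * q + 1), x ^ (2 * q - k) * y ^ k =
      ∑ k ∈ Finset.range (2 * q + 1), x ^ k * y ^ (2 * q - k) := by
    rw [← Finset.sum_range_reflect]
    refine Finset.sum_congr rfl fun k hk => ?_
    have := Finset.mem_range.1 hk
    rw [show 2 * q + 1 - 1 - k = 2 * q - k by omega, show 2 * q - (2 * q - k) = k by omega]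
  rw [hrefl] at hsum
  push_cast at hsum
  linarith

/-- Mean value trace inequality for even powers of symmetric operators. -/
theorem sum_trace_mul_pow_mul_pow_le {D X Y : E →ₗ[ℝ] E} (hD : D.IsSymmetric)
    (hX : X.IsSymmetric) (hY : Y.IsSymmetric) {r : ℝ} (hr : ∀ v, ‖D v‖ ≤ r * ‖v‖) (q : ℕ) :
    ∑ k ∈ Finset.range (2 * q + 1),
        LinearMap.trace ℝ E (D * (X ^ k * (D * Y ^ (2 * q - k)))) ≤
      (2 * q + 1) / 2 * (r ^ 2 * (LinearMap.trace ℝ E (X ^ (2 * q)) +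
        LinearMap.trace ℝ E (Y ^ (2 * q)))) := by
  have hd : Module.finrank ℝ E = Module.finrank ℝ E := rfl
  have hunit : ∀ v : E, ‖v‖ = 1 → ‖D v‖ ≤ r := fun v hv => by
    simpa [hv] using hr v
  simp_rw [trace_mul_pow_mul_pow_eq_sum hD hX hY hd, trace_pow_eq_sum hX hd,
    trace_pow_eq_sum hY hd]
  set u := hX.eigenvectorBasis hd
  set w := hY.eigenvectorBasis hd
  set s := hX.eigenvalues hd
  set t := hY.eigenvalues hd
  calc ∑ k ∈ Finset.range (2 * q + 1), ∑ j, ∑ i,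
        s i ^ k * t j ^ (2 * q - k) * inner ℝ (u i) (D (w j)) ^ 2
      = ∑ j, ∑ i, (∑ k ∈ Finset.range (2 * q + 1), s i ^ k * t j ^ (2 * q - k)) *
          inner ℝ (u i) (D (w j)) ^ 2 := by
        rw [Finset.sum_comm]
        refine Finset.sum_congr rfl fun j _ => ?_
        rw [Finset.sum_comm]
        simp_rw [Finset.sum_mul]
    _ ≤ ∑ j, ∑ i, ((2 * q + 1) / 2 * (s i ^ (2 * q) + t j ^ (2 * q))) *
          inner ℝ (u i) (D (w j)) ^ 2 := by
        gcongr with j _ i _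
        exact sum_pow_mul_pow_le _ _ _
    -- Parseval: summing the weights over one eigenbasis gives the squared norm of `D` on a vector
    -- of the other.
    _ = (2 * q + 1) / 2 * ((∑ i, s i ^ (2 * q) * ‖D (u i)‖ ^ 2) +
          ∑ j, t j ^ (2 * q) * ‖D (w j)‖ ^ 2) := by
        have h1 : ∀ j, ‖D (w j)‖ ^ 2 = ∑ i, inner ℝ (u i) (D (w j)) ^ 2 := fun j =>
          (u.sum_sq_inner_right _).symm
        have h2 : ∀ i, ‖D (u i)‖ ^ 2 = ∑ j, inner ℝ (u i) (D (w j)) ^ 2 := fun i => by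
          rw [← w.sum_sq_inner_left (D (u i))]
          exact Finset.sum_congr rfl fun j _ => by rw [hD]
        simp_rw [h1, h2, Finset.mul_sum]
        rw [Finset.sum_comm (f := fun i j => s i ^ (2 * q) * inner ℝ (u i) (D (w j)) ^ 2),
          ← Finset.sum_add_distrib, Finset.mul_sum]
        refine Finset.sum_congr rfl fun j _ => ?_
        rw [← Finset.sum_add_distrib, Finset.mul_sum]
        exact Finset.sum_congr rfl fun i _ => by ring
    _ ≤ (2 * q + 1) / 2 * ((∑ i, s i ^ (2 * q) * r ^ 2) + ∑ j, t j ^ (2 * q) * r ^ 2) := by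
        have hs : ∀ i, 0 ≤ s i ^ (2 * q) := fun i => (even_two_mul q).pow_nonneg _
        have ht : ∀ i, 0 ≤ t i ^ (2 * q) := fun i => (even_two_mul q).pow_nonneg _
        gcongr with i _ j _
        · exact hs i
        · exact hunit _ (u.orthonormal.1 i)
        · exact ht j
        · exact hunit _ (w.orthonormal.1 j)
    _ = _ := by rw [← Finset.sum_mul, ← Finset.sum_mul]; ring

theorem trace_pow_even_nonneg {T : E →ₗ[ℝ] E} (hT : T.IsSymmetric) (p : ℕ) :
    0 ≤ LinearMap.trace ℝ E (T ^ (2 * p)) := by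
  rw [trace_pow_eq_sum hT rfl]
  exact Finset.sum_nonneg fun i _ => (even_two_mul p).pow_nonneg _

/-- A vector stretched by more than `t` forces an eigenvalue of modulus above `t`, and the trace of
an even power dominates each of its terms. -/
theorem pow_le_trace_pow {T : E →ₗ[ℝ] E} (hT : T.IsSymmetric) {t : ℝ} (ht : 0 ≤ t) {v : E}
    (hv : t * ‖v‖ < ‖T v‖) (p : ℕ) : t ^ (2 * p) ≤ LinearMap.trace ℝ E (T ^ (2 * p)) := by
  have hd : Module.finrank ℝ E = Module.finrank ℝ E := rfl
  have h : ∃ i, t < |hT.eigenvalues hd i| := by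
    by_contra! hc
    have h1 : ‖T v‖ ^ 2 ≤ (t * ‖v‖) ^ 2 := by
      rw [← real_inner_self_eq_norm_sq, hT]
      have := inner_pow_eq_sum hT hd 2 v
      rw [pow_two, Module.End.mul_apply] at this
      rw [this, mul_pow, ← (hT.eigenvectorBasis hd).sum_sq_inner_right v, Finset.mul_sum]
      refine Finset.sum_le_sum fun i _ => mul_le_mul_of_nonneg_right ?_ (sq_nonneg _)
      exact sq_le_sq' (neg_le_of_abs_le (hc i)) (le_of_abs_le (hc i))
    exact absurd (abs_le_of_sq_le_sq h1 (by positivity)) (by simpa using hv)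
  obtain ⟨i, hi⟩ := h
  rw [trace_pow_eq_sum hT hd]
  refine le_trans ?_ (Finset.single_le_sum
    (fun j _ => (even_two_mul p).pow_nonneg (hT.eigenvalues hd j)) (Finset.mem_univ i))
  rw [← (even_two_mul p).pow_abs (hT.eigenvalues hd i)]
  exact pow_le_pow_left₀ ht hi.le _

end Trace

/-! ### Moment recursion by exchangeable pairs -/

section Moments

theorem pow_succ_sub_pow_succ_eq_sum {A : Type*} [Ring A] (X Y : A) (n : ℕ) :
    X ^ (n + 1) - Y ^ (n + 1) =
      ∑ k ∈ Finset.range (n + 1), X ^ k * ((X - Y) * Y ^ (n - k)) := by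
  induction n with
  | zero => simp
  | succ n ih =>
    rw [Finset.sum_range_succ']
    have : ∀ k, X ^ (k + 1) * ((X - Y) * Y ^ (n + 1 - (k + 1))) =
        X * (X ^ k * ((X - Y) * Y ^ (n - k))) := fun k => by
      rw [Nat.add_sub_add_right, pow_succ', mul_assoc]
    simp_rw [this]
    rw [← Finset.mul_sum, ← ih, pow_succ' X (n + 1), pow_succ' Y (n + 1)]
    simp only [pow_zero, one_mul, Nat.sub_zero, pow_succ' Y n]
    noncomm_ring

/-- Resampling coordinate `i` of a finite sequence is an exchangeable operation. -/
theorem sum_sum_update_swap {N b : ℕ} (i : Fin b) (F : (Fin b → Fin N) → Fin N → ℝ) :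
    ∑ β, ∑ j, F (Function.update β i j) (β i) = ∑ β, ∑ j, F β j := by
  rw [← Finset.sum_product', ← Finset.sum_product']
  have hinv : Function.Involutive
      (fun z : (Fin b → Fin N) × Fin N => (Function.update z.1 i z.2, z.1 i)) := fun z => by
    simp
  exact Equiv.sum_comp hinv.toPerm (fun z : (Fin b → Fin N) × Fin N => F z.1 z.2)

variable {E : Type*} [NormedAddCommGroup E] [InnerProductSpace ℝ E]

/-- The sum of the operators selected by a finite sequence of indices. -/
def batchSum {N b : ℕ} (a : Fin N → E →ₗ[ℝ] E) (β : Fin b → Fin N) : E →ₗ[ℝ] E :=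
  ∑ k, a (β k)

theorem batchSum_update {N b : ℕ} (a : Fin N → E →ₗ[ℝ] E) (β : Fin b → Fin N) (i : Fin b)
    (j : Fin N) : batchSum a β - batchSum a (Function.update β i j) = a (β i) - a j := by
  unfold batchSum
  rw [← Finset.sum_sub_distrib, Finset.sum_eq_single i]
  · simp
  · intro k _ hk
    simp [hk]
  · simp

theorem batchSum_isSymmetric {N b : ℕ} {a : Fin N → E →ₗ[ℝ] E} (ha : ∀ i, (a i).IsSymmetric)
    (β : Fin b → Fin N) : (batchSum a β).IsSymmetric := fun v w => by
  simp only [batchSum, LinearMap.sum_apply, sum_inner, inner_sum]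
  exact Finset.sum_congr rfl fun k _ => ha _ _ _

variable [FiniteDimensional ℝ E]

/-- The (unnormalised) even trace moments of the random sum `batchSum a`. -/
def traceMoment {N : ℕ} (b : ℕ) (a : Fin N → E →ₗ[ℝ] E) (p : ℕ) : ℝ :=
  ∑ β : Fin b → Fin N, LinearMap.trace ℝ E (batchSum a β ^ (2 * p))

/-- Integration by parts for an exchangeable pair: antisymmetrizing under the resampling of entry
`i` turns `S^(2p+1)` into a difference of powers, which the mean value trace inequality controls by
moments of order `2p`. -/
theorem sum_trace_mul_batchSum_pow_le {N b : ℕ} (hN : 0 < N) {a : Fin N → E →ₗ[ℝ] E}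
    (ha : ∀ i, (a i).IsSymmetric) (h0 : ∑ i, a i = 0) {R : ℝ}
    (hR : ∀ i v, ‖a i v‖ ≤ R * ‖v‖) (p : ℕ) (i : Fin b) :
    ∑ β : Fin b → Fin N, LinearMap.trace ℝ E (a (β i) * batchSum a β ^ (2 * p + 1)) ≤
      (2 * p + 1) * (2 * R ^ 2) * traceMoment b a p := by
  have hN' : (0 : ℝ) < N := by exact_mod_cast hN
  set S := batchSum (b := b) a
  set tr := LinearMap.trace ℝ E
  have hcenter : ∑ β, ∑ j, tr (a j * S β ^ (2 * p + 1)) = 0 := by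
    refine Finset.sum_eq_zero fun β _ => ?_
    rw [← map_sum, ← Finset.sum_mul, h0, zero_mul, map_zero]
  -- By centering, subtracting an independent fresh copy `a j` costs nothing.
  have hT : N * ∑ β, tr (a (β i) * S β ^ (2 * p + 1)) =
      ∑ β, ∑ j, tr ((a (β i) - a j) * S β ^ (2 * p + 1)) := by
    simp_rw [sub_mul, map_sub, Finset.sum_sub_distrib]
    rw [hcenter, sub_zero, Finset.mul_sum]
    simp
  have hswap := sum_sum_update_swap i (fun β j => tr ((a (β i) - a j) * S β ^ (2 * p + 1)))
  simp only [Function.update_self] at hswap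
  have hM := sum_sum_update_swap i (fun β (_ : Fin N) => tr (S β ^ (2 * p)))
  have hM' : ∑ β, ∑ _j : Fin N, tr (S β ^ (2 * p)) = N * traceMoment b a p := by
    simp [traceMoment, Finset.mul_sum, S, tr]
  have hpt : ∀ β j, tr ((a (β i) - a j) * S β ^ (2 * p + 1)) +
      tr ((a j - a (β i)) * S (Function.update β i j) ^ (2 * p + 1)) ≤
      (2 * p + 1) / 2 * ((2 * R) ^ 2 * (tr (S β ^ (2 * p)) +
        tr (S (Function.update β i j) ^ (2 * p)))) := by
    intro β j
    have hsymm : (a (β i) - a j).IsSymmetric := (ha _).sub (ha _)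
    have hnorm : ∀ v, ‖(a (β i) - a j) v‖ ≤ 2 * R * ‖v‖ := fun v => by
      rw [LinearMap.sub_apply]
      linarith [norm_sub_le (a (β i) v) (a j v), hR (β i) v, hR j v]
    refine le_trans (le_of_eq ?_) (sum_trace_mul_pow_mul_pow_le hsymm
      (batchSum_isSymmetric ha β) (batchSum_isSymmetric ha (Function.update β i j)) hnorm p)
    rw [← neg_sub (a (β i)) (a j), neg_mul, map_neg, ← sub_eq_add_neg, ← map_sub, ← mul_sub,
      pow_succ_sub_pow_succ_eq_sum, batchSum_update, Finset.mul_sum, map_sum]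
  -- Exchangeability makes the two terms on the left of `hpt` equal after summation, and likewise
  -- the two traces on the right.
  have hsum := Finset.sum_le_sum fun β (_ : β ∈ Finset.univ) =>
    Finset.sum_le_sum fun j (_ : j ∈ Finset.univ) => hpt β j
  simp_rw [← Finset.mul_sum, Finset.sum_add_distrib] at hsum
  rw [hswap, hM, hM', ← hT] at hsum
  refine le_of_mul_le_mul_left ?_ hN'
  linarith

/-- One factor of the power is expanded into its `b` summands, each bounded by the previous lemma.
-/
theorem traceMoment_succ_le {N b : ℕ} (hN : 0 < N) {a : Fin N → E →ₗ[ℝ] E}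
    (ha : ∀ i, (a i).IsSymmetric) (h0 : ∑ i, a i = 0) {R : ℝ}
    (hR : ∀ i v, ‖a i v‖ ≤ R * ‖v‖) (p : ℕ) :
    traceMoment b a (p + 1) ≤ b * ((2 * p + 1) * (2 * R ^ 2)) * traceMoment b a p := by
  have : traceMoment b a (p + 1) = ∑ i, ∑ β : Fin b → Fin N,
      LinearMap.trace ℝ E (a (β i) * batchSum a β ^ (2 * p + 1)) := by
    rw [Finset.sum_comm]
    refine Finset.sum_congr rfl fun β _ => ?_
    rw [← map_sum, ← Finset.sum_mul, mul_add, mul_one, pow_succ' _ (2 * p + 1)]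
    rfl
  rw [this]
  refine (Finset.sum_le_sum fun i _ =>
    sum_trace_mul_batchSum_pow_le hN ha h0 hR p i).trans (le_of_eq ?_)
  simp
  ring

theorem traceMoment_nonneg {N b : ℕ} {a : Fin N → E →ₗ[ℝ] E}
    (ha : ∀ i, (a i).IsSymmetric) (p : ℕ) : 0 ≤ traceMoment b a p :=
  Finset.sum_nonneg fun β _ => trace_pow_even_nonneg (batchSum_isSymmetric ha β) p

/-- `P` stays fixed during the induction on `p`, so that each recursion factor is bounded by the
same constant: `2(2p + 1) ≤ 4P` when `p + 1 ≤ P`. -/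
theorem traceMoment_le {N b : ℕ} (hN : 0 < N) {a : Fin N → E →ₗ[ℝ] E}
    (ha : ∀ i, (a i).IsSymmetric) (h0 : ∑ i, a i = 0) {R : ℝ}
    (hR : ∀ i v, ‖a i v‖ ≤ R * ‖v‖) (P p : ℕ) (hp : p ≤ P) :
    traceMoment b a p ≤ Module.finrank ℝ E * (N : ℝ) ^ b * (4 * P * b * R ^ 2) ^ p := by
  induction p with
  | zero => simp [traceMoment, LinearMap.trace_one, mul_comm]
  | succ p ih =>
    have hpP : (p : ℝ) + 1 ≤ P := by exact_mod_cast hp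
    calc traceMoment b a (p + 1) ≤ _ := traceMoment_succ_le hN ha h0 hR p
      _ ≤ (4 * P * b * R ^ 2) * traceMoment b a p := by
        refine mul_le_mul_of_nonneg_right ?_ (traceMoment_nonneg ha p)
        have : (0 : ℝ) ≤ b * R ^ 2 := by positivity
        nlinarith
      _ ≤ (4 * P * b * R ^ 2) *
          (Module.finrank ℝ E * (N : ℝ) ^ b * (4 * P * b * R ^ 2) ^ p) := by
        gcongr
        exact ih (by omega)
      _ = _ := by ring

/-- Moment form of the concentration of a sum of operators sampled with replacement. -/
theorem card_batchSum_large_le {N b : ℕ} (hN : 0 < N) {a : Fin N → E →ₗ[ℝ] E}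
    (ha : ∀ i, (a i).IsSymmetric) (h0 : ∑ i, a i = 0) {R : ℝ}
    (hR : ∀ i v, ‖a i v‖ ≤ R * ‖v‖) (p : ℕ) {t : ℝ} (ht : 0 ≤ t)
    (s : Finset (Fin b → Fin N)) (hs : ∀ β ∈ s, ∃ v, t * ‖v‖ < ‖batchSum a β v‖) :
    s.card * t ^ (2 * p) ≤ Module.finrank ℝ E * (N : ℝ) ^ b * (4 * p * b * R ^ 2) ^ p := by
  refine le_trans ?_ (traceMoment_le hN ha h0 hR p p le_rfl)
  calc s.card * t ^ (2 * p) = ∑ β ∈ s, t ^ (2 * p) := by simp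
    _ ≤ ∑ β ∈ s, LinearMap.trace ℝ E (batchSum a β ^ (2 * p)) := by
      refine Finset.sum_le_sum fun β hβ => ?_
      obtain ⟨v, hv⟩ := hs β hβ
      exact pow_le_trace_pow (batchSum_isSymmetric ha β) ht hv p
    _ ≤ _ := Finset.sum_le_sum_of_subset_of_nonneg (Finset.subset_univ s) fun β _ _ =>
      trace_pow_even_nonneg (batchSum_isSymmetric ha β) p

end Moments

/-! ### Self-adjoint dilation of rectangular operators -/

section Dilation

variable {F G : Type*} [NormedAddCommGroup F] [InnerProductSpace ℝ F] [FiniteDimensional ℝ F]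
  [NormedAddCommGroup G] [InnerProductSpace ℝ G] [FiniteDimensional ℝ G]

/-- The self-adjoint dilation `(u, v) ↦ (A† v, A u)` of an operator `A`. -/
def dilation : (F →L[ℝ] G) →ₗ[ℝ] (WithLp 2 (F × G) →ₗ[ℝ] WithLp 2 (F × G)) where
  toFun A :=
    { toFun := fun z => WithLp.toLp 2 (ContinuousLinearMap.adjoint A z.snd, A z.fst)
      map_add' := fun z z' => by simp [← WithLp.toLp_add]
      map_smul' := fun c z => by simp [← WithLp.toLp_smul] }
  map_add' A A' := LinearMap.ext fun z => by simp; rfl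
  map_smul' c A := LinearMap.ext fun z => by simp; rfl

theorem dilation_apply (A : F →L[ℝ] G) (z : WithLp 2 (F × G)) :
    dilation A z = WithLp.toLp 2 (ContinuousLinearMap.adjoint A z.snd, A z.fst) := rfl

theorem dilation_isSymmetric (A : F →L[ℝ] G) : (dilation A).IsSymmetric := fun z w => by
  simp only [dilation_apply, WithLp.prod_inner_apply]
  rw [ContinuousLinearMap.adjoint_inner_left, ContinuousLinearMap.adjoint_inner_right, add_comm]
  rfl

theorem norm_dilation_apply_le {A : F →L[ℝ] G} {R : ℝ} (hA : ‖A‖ ≤ R)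
    (z : WithLp 2 (F × G)) : ‖dilation A z‖ ≤ R * ‖z‖ := by
  have hR : 0 ≤ R := (norm_nonneg _).trans hA
  refine le_of_sq_le_sq ?_ (by positivity)
  rw [mul_pow, WithLp.prod_norm_sq_eq_of_L2, WithLp.prod_norm_sq_eq_of_L2]
  have h1 : ‖A z.fst‖ ≤ R * ‖z.fst‖ := A.le_of_opNorm_le hA _
  have h2 : ‖ContinuousLinearMap.adjoint A z.snd‖ ≤ R * ‖z.snd‖ :=
    ContinuousLinearMap.le_of_opNorm_le _
      ((LinearIsometryEquiv.norm_map ContinuousLinearMap.adjoint A).trans_le hA) _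
  have h3 := pow_le_pow_left₀ (norm_nonneg _) h1 2
  have h4 := pow_le_pow_left₀ (norm_nonneg _) h2 2
  simp only [dilation_apply, WithLp.toLp_fst, WithLp.toLp_snd]
  linarith

theorem exists_lt_norm_dilation_apply {A : F →L[ℝ] G} {t : ℝ} (ht : 0 ≤ t) (hA : t < ‖A‖) :
    ∃ z, t * ‖z‖ < ‖dilation A z‖ := by
  by_contra! h
  refine hA.not_ge (A.opNorm_le_bound ht fun v => ?_)
  have := h (WithLp.toLp 2 (v, 0))
  simpa [dilation_apply] using this

end Dilation

/-! ### Concentration of mini-batch means -/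

section Sampling

variable {Ω : Type*} [MeasurableSpace Ω] {P : Measure Ω} {N b : ℕ}

theorem IsUniformBatch.measurableSet {B : Fin b → Ω → Fin N} (hB : IsUniformBatch P B)
    (s : Set (Fin b → Fin N)) : MeasurableSet {ω | (fun k => B k ω) ∈ s} :=
  (measurable_pi_lambda _ hB.measurable) s.to_countable.measurableSet

/-- Independence makes every index sequence equally likely, so probabilities become counts. -/
theorem IsUniformBatch.measureReal_eq [IsProbabilityMeasure P] {B : Fin b → Ω → Fin N}
    (hB : IsUniformBatch P B) (s : Finset (Fin b → Fin N)) :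
    P.real {ω | (fun k => B k ω) ∈ s} = s.card / (N : ℝ) ^ b := by
  have h1 : ∀ β : Fin b → Fin N,
      P.real ((fun ω k => B k ω) ⁻¹' {β}) = 1 / (N : ℝ) ^ b := by
    intro β
    have : (fun ω k => B k ω) ⁻¹' {β} = ⋂ k ∈ Finset.univ, B k ⁻¹' {β k} := by
      ext ω
      simp [funext_iff]
    rw [this, measureReal_def, hB.indep.measure_inter_preimage_eq_mul Finset.univ
      (fun k _ => MeasurableSet.singleton _), ENNReal.toReal_prod]
    have h : ∀ k, (P (B k ⁻¹' {β k})).toReal = 1 / (N : ℝ) := fun k => hB.uniform k (β k)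
    simp [h]
  have h2 := sum_measureReal_preimage_singleton (μ := P) s (f := fun ω k => B k ω)
    (fun β _ => hB.measurableSet {β})
  rw [Finset.sum_congr rfl fun β _ => h1 β] at h2
  have h3 : {ω | (fun k => B k ω) ∈ s} = (fun ω k => B k ω) ⁻¹' s := rfl
  rw [h3, ← h2]
  simp [div_eq_mul_inv]

variable {F G : Type*} [NormedAddCommGroup F] [InnerProductSpace ℝ F] [FiniteDimensional ℝ F]
  [NormedAddCommGroup G] [InnerProductSpace ℝ G] [FiniteDimensional ℝ G]

/-- The moment bound is applied to dilations of the centered operators `w i - M`; centering at most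
doubles the norm bound, whence `2 * L`. -/
theorem card_batchMean_large_le (hN : 0 < N) (hb : 0 < b) (w : Fin N → F →L[ℝ] G) {L ε : ℝ}
    (hw : ∀ i, ‖w i‖ ≤ L) (hε : 0 ≤ ε) (p : ℕ) (s : Finset (Fin b → Fin N))
    (hs : ∀ β ∈ s, ε < ‖batchMean β w - (1 / (N : ℝ)) • ∑ i, w i‖) :
    s.card * (b * ε) ^ (2 * p) ≤
      ((Module.finrank ℝ F + Module.finrank ℝ G : ℕ) : ℝ) * (N : ℝ) ^ b *
        (4 * p * b * (2 * L) ^ 2) ^ p := by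
  have hb' : (0 : ℝ) < b := by exact_mod_cast hb
  have hN' : (0 : ℝ) < N := by exact_mod_cast hN
  set M := (1 / (N : ℝ)) • ∑ i, w i with hM
  have hML : ‖M‖ ≤ L := by
    rw [hM, norm_smul, Real.norm_of_nonneg (by positivity), one_div, inv_mul_le_iff₀ hN']
    refine (norm_sum_le _ _).trans ((Finset.sum_le_sum fun i _ => hw i).trans ?_)
    simp
  have hfin : Module.finrank ℝ (WithLp 2 (F × G)) =
      Module.finrank ℝ F + Module.finrank ℝ G := by
    rw [(WithLp.linearEquiv 2 ℝ (F × G)).finrank_eq, Module.finrank_prod]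
  rw [← hfin]
  refine card_batchSum_large_le hN (a := fun i => dilation (w i - M))
    (fun i => dilation_isSymmetric _) ?_
    (fun i v => norm_dilation_apply_le (R := 2 * L) ?_ v) p (by positivity) s fun β hβ => ?_
  · rw [← map_sum, Finset.sum_sub_distrib, hM]
    simp [← Nat.cast_smul_eq_nsmul ℝ, smul_smul, hN'.ne']
  · linarith [norm_sub_le (w i) M, hw i]
  · have hsum : batchSum (fun i => dilation (w i - M)) β =
        dilation ((b : ℝ) • (batchMean β w - M)) := by
      simp only [batchSum, batchMean]
      rw [← map_sum, Finset.sum_sub_distrib, smul_sub, smul_smul]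
      simp [← Nat.cast_smul_eq_nsmul ℝ, hb'.ne']
    rw [hsum]
    refine exists_lt_norm_dilation_apply (by positivity) ?_
    rw [norm_smul, Real.norm_of_nonneg hb'.le]
    exact mul_lt_mul_of_pos_left (hs β hβ) hb'

/-- Concentration of mini-batch means of bounded operators, with logarithmic dependence on the
dimension. -/
theorem IsUniformBatch.measureReal_batchMean_large_le [IsProbabilityMeasure P]
    {B : Fin b → Ω → Fin N} (hB : IsUniformBatch P B) (hN : 0 < N) (hb : 0 < b)
    (w : Fin N → F →L[ℝ] G) {L ε δ D : ℝ} (hw : ∀ i, ‖w i‖ ≤ L) (hL : 0 < L) (hε : 0 < ε)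
    (hδ : 0 < δ) (hD : 2 ≤ D / δ)
    (hd : ((Module.finrank ℝ F + Module.finrank ℝ G : ℕ) : ℝ) ≤ 2 * D)
    (hbL : 336 * (L ^ 2 / ε ^ 2 * Real.log (D / δ)) ≤ b) :
    P.real {ω | ε < ‖batchMean (fun k => B k ω) w - (1 / (N : ℝ)) • ∑ i, w i‖} ≤ δ / 5 := by
  classical
  have hb' : (0 : ℝ) < b := by exact_mod_cast hb
  have hN' : (0 : ℝ) < N := by exact_mod_cast hN
  set ℓ := Real.log (D / δ) with hℓ
  set s : Finset (Fin b → Fin N) :=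
    Finset.univ.filter fun β => ε < ‖batchMean β w - (1 / (N : ℝ)) • ∑ i, w i‖ with hs
  have hset : {ω | ε < ‖batchMean (fun k => B k ω) w - (1 / (N : ℝ)) • ∑ i, w i‖} =
      {ω | (fun k => B k ω) ∈ s} := by
    ext ω
    simp [hs]
  rw [hset, hB.measureReal_eq]
  have hlog2 := Real.log_two_gt_d9
  have hℓ2 : Real.log 2 ≤ ℓ := Real.log_le_log (by norm_num) hD
  -- Chosen so that `exp (-p) ≤ δ / (16 D)`. Since `ℓ ≥ log 2 > 1/2`, rounding up still leaves `p ≤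
  -- 7ℓ`.
  set p := ⌈4 * Real.log 2 + ℓ⌉₊ with hp
  have hp1 : 4 * Real.log 2 + ℓ ≤ p := Nat.le_ceil _
  have hp2 : (p : ℝ) ≤ 7 * ℓ := by
    have := Nat.ceil_lt_add_one (a := 4 * Real.log 2 + ℓ) (by linarith)
    rw [← hp] at this
    linarith
  have hbound := card_batchMean_large_le hN hb w hw hε.le p s
    (fun β hβ => (Finset.mem_filter.1 hβ).2)
  -- The constant is 336 = 3 · 16 · 7, from `e ≤ 3`, the factor `4 · 2²`, and `p ≤ 7ℓ`.
  have hratio : 4 * p * b * (2 * L) ^ 2 ≤ Real.exp (-1) * (b * ε) ^ 2 := by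
    have he : Real.exp 1 ≤ 3 := by linarith [Real.exp_one_lt_d9]
    have h1 : 336 * L ^ 2 * ℓ ≤ b * ε ^ 2 := by
      have : 336 * (L ^ 2 / ε ^ 2 * ℓ) = 336 * L ^ 2 * ℓ / ε ^ 2 := by ring
      rw [this, div_le_iff₀ (by positivity)] at hbL
      exact hbL
    have h2 : Real.exp 1 * (16 * p * L ^ 2) ≤ b * ε ^ 2 := by
      refine le_trans ?_ h1
      calc Real.exp 1 * (16 * p * L ^ 2) ≤ 3 * (16 * (7 * ℓ) * L ^ 2) := by gcongr
        _ = _ := by ring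
    rw [Real.exp_neg, ← div_eq_inv_mul, le_div_iff₀ (Real.exp_pos 1)]
    nlinarith
  have hexp : Real.exp (-1) ^ p ≤ δ / (16 * D) := by
    have hD0 : 0 < D / δ := by linarith
    have h16 : Real.log (16 * (D / δ)) ≤ p := by
      rw [Real.log_mul (by norm_num) hD0.ne']
      have : Real.log 16 = 4 * Real.log 2 := by
        rw [show (16 : ℝ) = 2 ^ 4 by norm_num, Real.log_pow]
        norm_num
      linarith
    rw [← Real.exp_nat_mul, mul_neg_one, Real.exp_neg,
      show δ / (16 * D) = (16 * (D / δ))⁻¹ by rw [← mul_div_assoc, inv_div]]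
    exact inv_anti₀ (by positivity) ((Real.log_le_iff_le_exp (by positivity)).1 h16)
  have hDpos : 0 < D := by
    have : 0 < D / δ := by linarith
    exact (div_pos_iff_of_pos_right hδ).1 this
  rw [div_le_iff₀ (by positivity)]
  have hpos : 0 < (b * ε) ^ (2 * p) := by positivity
  refine le_of_mul_le_mul_right (hbound.trans ?_) hpos
  calc ((Module.finrank ℝ F + Module.finrank ℝ G : ℕ) : ℝ) * (N : ℝ) ^ b *
        (4 * p * b * (2 * L) ^ 2) ^ p
      ≤ (2 * D) * (N : ℝ) ^ b * (Real.exp (-1) * (b * ε) ^ 2) ^ p := by gcongr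
    _ = (2 * D) * (N : ℝ) ^ b * (Real.exp (-1) ^ p * (b * ε) ^ (2 * p)) := by
        rw [mul_pow, ← pow_mul]
    _ ≤ (2 * D) * (N : ℝ) ^ b * (δ / (16 * D) * (b * ε) ^ (2 * p)) := by gcongr
    _ = δ / 8 * (N : ℝ) ^ b * (b * ε) ^ (2 * p) := by field_simp; norm_num
    _ ≤ δ / 5 * (N : ℝ) ^ b * (b * ε) ^ (2 * p) := by gcongr; norm_num

/-- Concentration of mini-batch means of bounded vectors. -/
theorem IsUniformBatch.measureReal_batchMean_vector_large_le [IsProbabilityMeasure P]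
    {B : Fin b → Ω → Fin N} (hB : IsUniformBatch P B) (hN : 0 < N) (hb : 0 < b)
    (w : Fin N → F) {L ε δ D : ℝ} (hw : ∀ i, ‖w i‖ ≤ L) (hL : 0 < L) (hε : 0 < ε)
    (hδ : 0 < δ) (hD : 2 ≤ D / δ)
    (hd : ((Module.finrank ℝ F + 1 : ℕ) : ℝ) ≤ 2 * D)
    (hbL : 336 * (L ^ 2 / ε ^ 2 * Real.log (D / δ)) ≤ b) :
    P.real {ω | ε < ‖batchMean (fun k => B k ω) w - (1 / (N : ℝ)) • ∑ i, w i‖} ≤ δ / 5 := by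
  -- Vectors embed isometrically as functionals into `ℝ`, which adds one to the dimension.
  have h := hB.measureReal_batchMean_large_le hN hb (fun i => innerSL ℝ (w i))
    (fun i => (innerSL_apply_norm _ _).trans_le (hw i)) hL hε hδ hD (by simpa using hd) hbL
  have hnorm : ∀ β : Fin b → Fin N,
      ‖batchMean β (fun i => innerSL ℝ (w i)) - (1 / (N : ℝ)) • ∑ i, innerSL ℝ (w i)‖ =
        ‖batchMean β w - (1 / (N : ℝ)) • ∑ i, w i‖ := by
    intro β
    rw [← innerSL_apply_norm ℝ (batchMean β w - _), map_sub]
    simp [batchMean]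
  simpa only [hnorm] using h

end Sampling

/-! ### Gradients and Hessian blocks of the samples and of their average -/

section Calculus

variable {m n N : ℕ}

/-- The pair `(x, y)` as a point of the Euclidean product. -/
def mkPair (x : Vec m) (y : Vec n) : Pair m n := WithLp.toLp 2 (x, y)

/-- The inclusion of the first factor. -/
def incl₁ : Vec m →L[ℝ] Pair m n :=
  (WithLp.prodContinuousLinearEquiv 2 ℝ (Vec m) (Vec n)).symm.toContinuousLinearMap ∘L
    ContinuousLinearMap.inl ℝ (Vec m) (Vec n)

/-- The inclusion of the second factor. -/
def incl₂ : Vec n →L[ℝ] Pair m n :=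
  (WithLp.prodContinuousLinearEquiv 2 ℝ (Vec m) (Vec n)).symm.toContinuousLinearMap ∘L
    ContinuousLinearMap.inr ℝ (Vec m) (Vec n)

/-- The projection to the first factor. -/
def proj₁ : Pair m n →L[ℝ] Vec m :=
  ContinuousLinearMap.fst ℝ (Vec m) (Vec n) ∘L
    (WithLp.prodContinuousLinearEquiv 2 ℝ (Vec m) (Vec n)).toContinuousLinearMap

/-- The projection to the second factor. -/
def proj₂ : Pair m n →L[ℝ] Vec n :=
  ContinuousLinearMap.snd ℝ (Vec m) (Vec n) ∘L
    (WithLp.prodContinuousLinearEquiv 2 ℝ (Vec m) (Vec n)).toContinuousLinearMap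

theorem incl₁_apply (x : Vec m) : (incl₁ x : Pair m n) = WithLp.toLp 2 (x, 0) := rfl

theorem incl₂_apply (y : Vec n) : (incl₂ y : Pair m n) = WithLp.toLp 2 (0, y) := rfl

theorem proj₁_apply (z : Pair m n) : proj₁ z = z.fst := rfl

theorem proj₂_apply (z : Pair m n) : proj₂ z = z.snd := rfl

theorem norm_incl₁_le : ‖(incl₁ : Vec m →L[ℝ] Pair m n)‖ ≤ 1 :=
  ContinuousLinearMap.opNorm_le_bound _ zero_le_one fun x => by simp [incl₁_apply]

theorem norm_incl₂_le : ‖(incl₂ : Vec n →L[ℝ] Pair m n)‖ ≤ 1 :=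
  ContinuousLinearMap.opNorm_le_bound _ zero_le_one fun x => by simp [incl₂_apply]

theorem norm_proj₁_le : ‖(proj₁ : Pair m n →L[ℝ] Vec m)‖ ≤ 1 :=
  ContinuousLinearMap.opNorm_le_bound _ zero_le_one fun z => by
    rw [one_mul, proj₁_apply]
    exact WithLp.norm_fst_le _ z

theorem norm_proj₂_le : ‖(proj₂ : Pair m n →L[ℝ] Vec n)‖ ≤ 1 :=
  ContinuousLinearMap.opNorm_le_bound _ zero_le_one fun z => by
    rw [one_mul, proj₂_apply]
    exact WithLp.norm_snd_le _ z

theorem hasFDerivAt_mkPair_left (x : Vec m) (y : Vec n) :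
    HasFDerivAt (fun x' => mkPair x' y) incl₁ x := by
  have : (fun x' => mkPair x' y) = fun x' : Vec m => incl₁ x' + mkPair 0 y := by
    funext x'
    simp [mkPair, incl₁_apply, ← WithLp.toLp_add]
  rw [this]
  exact (incl₁.hasFDerivAt).add_const _

theorem hasFDerivAt_mkPair_right (x : Vec m) (y : Vec n) :
    HasFDerivAt (fun y' => mkPair x y') incl₂ y := by
  have : (fun y' => mkPair x y') = fun y' : Vec n => incl₂ y' + mkPair x 0 := by
    funext y'
    simp [mkPair, incl₂_apply, ← WithLp.toLp_add]
  rw [this]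
  exact (incl₂.hasFDerivAt).add_const _

/-- Chain rule along an affine slice; the projection appears as the adjoint of the inclusion. -/
theorem hasGradientAt_left {f : Vec m → Vec n → ℝ} (hf : Differentiable ℝ (joint f))
    (x : Vec m) (y : Vec n) :
    HasGradientAt (fun x' => f x' y) (proj₁ (gradient (joint f) (mkPair x y))) x := by
  have h := ((hf (mkPair x y)).hasGradientAt.hasFDerivAt).comp x (hasFDerivAt_mkPair_left x y)
  rw [hasGradientAt_iff_hasFDerivAt]
  refine h.congr_fderiv (ContinuousLinearMap.ext fun v => ?_)
  rw [ContinuousLinearMap.comp_apply, InnerProductSpace.toDual_apply_apply,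
    InnerProductSpace.toDual_apply_apply, WithLp.prod_inner_apply]
  simp [incl₁_apply, proj₁_apply]

theorem hasGradientAt_right {f : Vec m → Vec n → ℝ} (hf : Differentiable ℝ (joint f))
    (x : Vec m) (y : Vec n) :
    HasGradientAt (fun y' => f x y') (proj₂ (gradient (joint f) (mkPair x y))) y := by
  have h := ((hf (mkPair x y)).hasGradientAt.hasFDerivAt).comp y (hasFDerivAt_mkPair_right x y)
  rw [hasGradientAt_iff_hasFDerivAt]
  refine h.congr_fderiv (ContinuousLinearMap.ext fun v => ?_)
  rw [ContinuousLinearMap.comp_apply, InnerProductSpace.toDual_apply_apply,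
    InnerProductSpace.toDual_apply_apply, WithLp.prod_inner_apply]
  simp [incl₂_apply, proj₂_apply]

theorem grad₁_eq {f : Vec m → Vec n → ℝ} (hf : Differentiable ℝ (joint f)) (x : Vec m)
    (y : Vec n) : grad₁ f x y = proj₁ (gradient (joint f) (mkPair x y)) :=
  (hasGradientAt_left hf x y).gradient

theorem grad₂_eq {f : Vec m → Vec n → ℝ} (hf : Differentiable ℝ (joint f)) (x : Vec m)
    (y : Vec n) : grad₂ f x y = proj₂ (gradient (joint f) (mkPair x y)) :=
  (hasGradientAt_right hf x y).gradient

/-- The full Hessian of `f`. -/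
def hess (f : Vec m → Vec n → ℝ) (z : Pair m n) : Pair m n →L[ℝ] Pair m n :=
  fderiv ℝ (gradient (joint f)) z

theorem jac₁₁_eq {f : Vec m → Vec n → ℝ} (hf : TwiceDifferentiable f) (x : Vec m) (y : Vec n) :
    jac₁₁ f x y = proj₁ ∘L hess f (mkPair x y) ∘L incl₁ := by
  unfold jac₁₁
  simp_rw [grad₁_eq hf.1]
  exact (proj₁.hasFDerivAt.comp x
    ((hf.2 (mkPair x y)).hasFDerivAt.comp x (hasFDerivAt_mkPair_left x y))).fderiv

theorem jac₁₂_eq {f : Vec m → Vec n → ℝ} (hf : TwiceDifferentiable f) (x : Vec m) (y : Vec n) :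
    jac₁₂ f x y = proj₁ ∘L hess f (mkPair x y) ∘L incl₂ := by
  unfold jac₁₂
  simp_rw [grad₁_eq hf.1]
  exact (proj₁.hasFDerivAt.comp y
    ((hf.2 (mkPair x y)).hasFDerivAt.comp y (hasFDerivAt_mkPair_right x y))).fderiv

theorem jac₂₁_eq {f : Vec m → Vec n → ℝ} (hf : TwiceDifferentiable f) (x : Vec m) (y : Vec n) :
    jac₂₁ f x y = proj₂ ∘L hess f (mkPair x y) ∘L incl₁ := by
  unfold jac₂₁
  simp_rw [grad₂_eq hf.1]
  exact (proj₂.hasFDerivAt.comp x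
    ((hf.2 (mkPair x y)).hasFDerivAt.comp x (hasFDerivAt_mkPair_left x y))).fderiv

theorem hasFDerivAt_grad₂_right {f : Vec m → Vec n → ℝ} (hf : TwiceDifferentiable f)
    (x : Vec m) (y : Vec n) :
    HasFDerivAt (fun y' => grad₂ f x y') (proj₂ ∘L hess f (mkPair x y) ∘L incl₂) y := by
  simp_rw [grad₂_eq hf.1]
  exact proj₂.hasFDerivAt.comp y
    ((hf.2 (mkPair x y)).hasFDerivAt.comp y (hasFDerivAt_mkPair_right x y))

theorem jac₂₂_eq {f : Vec m → Vec n → ℝ} (hf : TwiceDifferentiable f) (x : Vec m) (y : Vec n) :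
    jac₂₂ f x y = proj₂ ∘L hess f (mkPair x y) ∘L incl₂ :=
  (hasFDerivAt_grad₂_right hf x y).fderiv

theorem norm_comp_comp_le {E₁ E₂ E₃ : Type*} [NormedAddCommGroup E₁] [NormedSpace ℝ E₁]
    [NormedAddCommGroup E₂] [NormedSpace ℝ E₂] [NormedAddCommGroup E₃] [NormedSpace ℝ E₃]
    {p : E₂ →L[ℝ] E₃} {A : E₂ →L[ℝ] E₂} {i : E₁ →L[ℝ] E₂} {L : ℝ} (hp : ‖p‖ ≤ 1)
    (hA : ‖A‖ ≤ L) (hi : ‖i‖ ≤ 1) : ‖p ∘L A ∘L i‖ ≤ L := by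
  have hL : 0 ≤ L := (norm_nonneg _).trans hA
  calc ‖p ∘L A ∘L i‖ ≤ ‖p‖ * ‖A ∘L i‖ := p.opNorm_comp_le _
    _ ≤ ‖p‖ * (‖A‖ * ‖i‖) := by gcongr; exact A.opNorm_comp_le _
    _ ≤ 1 * (L * 1) := by gcongr
    _ = L := by ring

namespace SampleAssumption

variable {L₀ L₁ μ : ℝ} {f : Vec m → Vec n → ℝ}

theorem norm_hess_le (hf : SampleAssumption L₀ L₁ μ f) (hL : 0 ≤ L₁) (z : Pair m n) :
    ‖hess f z‖ ≤ L₁ :=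
  norm_fderiv_le_of_lip' ℝ hL (Filter.Eventually.of_forall fun w => hf.smooth.2 w z)

theorem norm_jac₁₁_le (hf : SampleAssumption L₀ L₁ μ f) (hL : 0 ≤ L₁) (x : Vec m) (y : Vec n) :
    ‖jac₁₁ f x y‖ ≤ L₁ := by
  rw [jac₁₁_eq hf.twiceDifferentiable]
  exact norm_comp_comp_le norm_proj₁_le (hf.norm_hess_le hL _) norm_incl₁_le

theorem norm_jac₁₂_le (hf : SampleAssumption L₀ L₁ μ f) (hL : 0 ≤ L₁) (x : Vec m) (y : Vec n) :
    ‖jac₁₂ f x y‖ ≤ L₁ := by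
  rw [jac₁₂_eq hf.twiceDifferentiable]
  exact norm_comp_comp_le norm_proj₁_le (hf.norm_hess_le hL _) norm_incl₂_le

theorem norm_jac₂₁_le (hf : SampleAssumption L₀ L₁ μ f) (hL : 0 ≤ L₁) (x : Vec m) (y : Vec n) :
    ‖jac₂₁ f x y‖ ≤ L₁ := by
  rw [jac₂₁_eq hf.twiceDifferentiable]
  exact norm_comp_comp_le norm_proj₂_le (hf.norm_hess_le hL _) norm_incl₁_le

theorem norm_jac₂₂_le (hf : SampleAssumption L₀ L₁ μ f) (hL : 0 ≤ L₁) (x : Vec m) (y : Vec n) :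
    ‖jac₂₂ f x y‖ ≤ L₁ := by
  rw [jac₂₂_eq hf.twiceDifferentiable]
  exact norm_comp_comp_le norm_proj₂_le (hf.norm_hess_le hL _) norm_incl₂_le

theorem norm_grad₁_le (hf : SampleAssumption L₀ L₁ μ f) (hL : 0 ≤ L₀) (x : Vec m) (y : Vec n) :
    ‖grad₁ f x y‖ ≤ L₀ := by
  unfold grad₁ gradient
  rw [LinearIsometryEquiv.norm_map]
  exact norm_fderiv_le_of_lip' ℝ hL (Filter.Eventually.of_forall fun w => hf.lipschitz y w x)

/-- The Hessian in the second argument of a strongly concave function is at most `-μ`. -/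
theorem inner_jac₂₂_le (hf : SampleAssumption L₀ L₁ μ f) (x : Vec m) (y v : Vec n) :
    inner ℝ (jac₂₂ f x y v) v ≤ -μ * ‖v‖ ^ 2 := by
  -- On a line, adding the quadratic back leaves a concave function. Its derivative is antitone, so
  -- the second derivative at 0 is nonpositive; no continuity of the Hessian is needed.
  set φ : ℝ → ℝ := fun t => f x (y + t • v) + μ / 2 * ‖y + t • v‖ ^ 2 with hφ
  have hline : ∀ t : ℝ, HasDerivAt (fun t : ℝ => y + t • v) v t := fun t => by
    simpa using ((hasDerivAt_id t).smul_const v).const_add y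
  have hconc : ConcaveOn ℝ Set.univ φ := by
    have h := (strongConcaveOn_iff_convex.1 (hf.strongConcave x)).comp_affineMap
      (AffineMap.lineMap y (y + v) : ℝ →ᵃ[ℝ] Vec n)
    rw [Set.preimage_univ] at h
    have hφ' : φ = (fun y' => f x y' + μ / 2 * ‖y'‖ ^ 2) ∘
        (AffineMap.lineMap y (y + v) : ℝ →ᵃ[ℝ] Vec n) := by
      funext t
      simp [hφ, AffineMap.lineMap_apply, add_comm]
    rw [hφ']
    exact h
  have hder : ∀ t, HasDerivAt φ
      (inner ℝ (grad₂ f x (y + t • v)) v + μ * inner ℝ (y + t • v) v) t := by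
    intro t
    have h1 : HasDerivAt (fun t : ℝ => f x (y + t • v)) (inner ℝ (grad₂ f x (y + t • v)) v) t := by
      have := (hasGradientAt_right hf.twiceDifferentiable.1 x (y + t • v)).hasFDerivAt.comp_hasDerivAt
        t (hline t)
      rw [grad₂_eq hf.twiceDifferentiable.1]
      exact this.congr_deriv (by simp)
    have h2 : HasDerivAt (fun t : ℝ => μ / 2 * ‖y + t • v‖ ^ 2) (μ * inner ℝ (y + t • v) v) t := by
      exact ((hline t).norm_sq.const_mul (μ / 2)).congr_deriv (by ring)
    exact h1.add h2
  have hanti : Antitone (deriv φ) := by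
    have := hconc.antitoneOn_deriv fun t _ => (hder t).differentiableAt
    exact antitoneOn_univ.1 this
  have hderiv : deriv φ =
      fun t => inner ℝ (grad₂ f x (y + t • v)) v + μ * inner ℝ (y + t • v) v :=
    funext fun t => (hder t).deriv
  have hsecond : HasDerivAt (deriv φ) (inner ℝ (jac₂₂ f x y v) v + μ * inner ℝ v v) 0 := by
    rw [hderiv, jac₂₂_eq hf.twiceDifferentiable]
    have hg : HasDerivAt (fun t : ℝ => grad₂ f x (y + t • v))
        ((proj₂ ∘L hess f (mkPair x y) ∘L incl₂) v) 0 := by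
      refine HasFDerivAt.comp_hasDerivAt (0 : ℝ) ?_ (hline 0)
      rw [zero_smul, add_zero]
      exact hasFDerivAt_grad₂_right hf.twiceDifferentiable x y
    have h1 := hg.inner ℝ (hasDerivAt_const (0 : ℝ) v)
    have h2 := ((hline 0).inner ℝ (hasDerivAt_const (0 : ℝ) v)).const_mul μ
    exact (h1.add h2).congr_deriv (by simp)
  have := hanti.deriv_nonpos (x := 0)
  rw [hsecond.deriv, real_inner_self_eq_norm_sq] at this
  linarith

end SampleAssumption

section Average

variable {f : Fin N → Vec m → Vec n → ℝ}

theorem hasGradientAt_joint_average (hf : ∀ i, Differentiable ℝ (joint (f i))) (z : Pair m n) :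
    HasGradientAt (joint (average f)) ((1 / (N : ℝ)) • ∑ i, gradient (joint (f i)) z) z := by
  rw [hasGradientAt_iff_hasFDerivAt]
  have h := (HasFDerivAt.fun_sum (u := Finset.univ)
    fun i _ => (hf i z).hasGradientAt.hasFDerivAt).const_mul (1 / (N : ℝ))
  exact h.congr_fderiv (by simp)

theorem twiceDifferentiable_average (hf : ∀ i, TwiceDifferentiable (f i)) :
    TwiceDifferentiable (average f) := by
  refine ⟨fun z => (hasGradientAt_joint_average (fun i => (hf i).1) z).differentiableAt, ?_⟩
  rw [gradient_eq (hasGradientAt_joint_average fun i => (hf i).1)]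
  exact (Differentiable.fun_sum (u := Finset.univ) fun i _ => (hf i).2).const_smul
    (1 / (N : ℝ))

theorem hess_average (hf : ∀ i, TwiceDifferentiable (f i)) (z : Pair m n) :
    hess (average f) z = (1 / (N : ℝ)) • ∑ i, hess (f i) z := by
  unfold hess
  rw [gradient_eq (hasGradientAt_joint_average fun i => (hf i).1)]
  have hd : ∀ i, DifferentiableAt ℝ (gradient (joint (f i))) z := fun i => (hf i).2 z
  have hs : DifferentiableAt ℝ (fun w => ∑ i, gradient (joint (f i)) w) z :=
    DifferentiableAt.fun_sum fun i _ => hd i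
  rw [fderiv_fun_const_smul hs, fderiv_fun_sum fun i _ => hd i]

theorem grad₁_average (hf : ∀ i, TwiceDifferentiable (f i)) (x : Vec m) (y : Vec n) :
    grad₁ (average f) x y = (1 / (N : ℝ)) • ∑ i, grad₁ (f i) x y := by
  have h : ∀ i, grad₁ (f i) x y = proj₁ (gradient (joint (f i)) (mkPair x y)) := fun i =>
    grad₁_eq (hf i).1 x y
  have ha := (hasGradientAt_joint_average (fun i => (hf i).1) (mkPair x y)).gradient
  rw [grad₁_eq (twiceDifferentiable_average hf).1 x y, ha, ContinuousLinearMap.map_smul, map_sum]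
  simp only [h]

theorem comp_smul_sum_comp {E₁ E₂ E₃ : Type*} [NormedAddCommGroup E₁] [NormedSpace ℝ E₁]
    [NormedAddCommGroup E₂] [NormedSpace ℝ E₂] [NormedAddCommGroup E₃] [NormedSpace ℝ E₃]
    (p : E₂ →L[ℝ] E₃) (A : Fin N → E₂ →L[ℝ] E₂) (i : E₁ →L[ℝ] E₂) (c : ℝ) :
    p ∘L (c • ∑ j, A j) ∘L i = c • ∑ j, p ∘L A j ∘L i := by
  ext v
  simp

theorem jac₁₁_average (hf : ∀ i, TwiceDifferentiable (f i)) (x : Vec m) (y : Vec n) :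
    jac₁₁ (average f) x y = (1 / (N : ℝ)) • ∑ i, jac₁₁ (f i) x y := by
  simp_rw [jac₁₁_eq (hf _), jac₁₁_eq (twiceDifferentiable_average hf), hess_average hf,
    comp_smul_sum_comp]

theorem jac₁₂_average (hf : ∀ i, TwiceDifferentiable (f i)) (x : Vec m) (y : Vec n) :
    jac₁₂ (average f) x y = (1 / (N : ℝ)) • ∑ i, jac₁₂ (f i) x y := by
  simp_rw [jac₁₂_eq (hf _), jac₁₂_eq (twiceDifferentiable_average hf), hess_average hf,
    comp_smul_sum_comp]

theorem jac₂₁_average (hf : ∀ i, TwiceDifferentiable (f i)) (x : Vec m) (y : Vec n) :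
    jac₂₁ (average f) x y = (1 / (N : ℝ)) • ∑ i, jac₂₁ (f i) x y := by
  simp_rw [jac₂₁_eq (hf _), jac₂₁_eq (twiceDifferentiable_average hf), hess_average hf,
    comp_smul_sum_comp]

theorem jac₂₂_average (hf : ∀ i, TwiceDifferentiable (f i)) (x : Vec m) (y : Vec n) :
    jac₂₂ (average f) x y = (1 / (N : ℝ)) • ∑ i, jac₂₂ (f i) x y := by
  simp_rw [jac₂₂_eq (hf _), jac₂₂_eq (twiceDifferentiable_average hf), hess_average hf,
    comp_smul_sum_comp]

end Average

end Calculus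

/-! ### Invertibility and perturbation of the Schur complement -/

section Schur

variable {m n : ℕ}

/-- Cauchy–Schwarz. This lower bound gives both injectivity and the bound on the inverse, without
any symmetry of `A`. -/
theorem mul_norm_le_of_inner_le {V : Type*} [NormedAddCommGroup V] [InnerProductSpace ℝ V]
    {A : V →L[ℝ] V} {μ : ℝ} (hA : ∀ v, inner ℝ (A v) v ≤ -μ * ‖v‖ ^ 2) (v : V) :
    μ * ‖v‖ ≤ ‖A v‖ := by
  rcases eq_or_ne v 0 with rfl | hv
  · simp
  have h1 := neg_le_of_abs_le (abs_real_inner_le_norm (A v) v)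
  have h2 : μ * ‖v‖ * ‖v‖ ≤ ‖A v‖ * ‖v‖ := by linarith [hA v, sq ‖v‖]
  exact le_of_mul_le_mul_right h2 (norm_pos_iff.2 hv)

theorem isInvertible_of_inner_le {V : Type*} [NormedAddCommGroup V] [InnerProductSpace ℝ V]
    [FiniteDimensional ℝ V] {A : V →L[ℝ] V} {μ : ℝ} (hμ : 0 < μ)
    (hA : ∀ v, inner ℝ (A v) v ≤ -μ * ‖v‖ ^ 2) : A.IsInvertible := by
  have hinj : Function.Injective (A : V →ₗ[ℝ] V) := by
    rw [injective_iff_map_eq_zero]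
    intro v hv
    have h : μ * ‖v‖ ≤ 0 := by
      simpa [show A v = 0 from hv] using mul_norm_le_of_inner_le hA v
    exact norm_le_zero_iff.1 (nonpos_of_mul_nonpos_right h hμ)
  exact ⟨(LinearEquiv.ofInjectiveEndo _ hinj).toContinuousLinearEquiv, by ext v; rfl⟩

theorem norm_inverse_le_of_inner_le {V : Type*} [NormedAddCommGroup V] [InnerProductSpace ℝ V]
    [FiniteDimensional ℝ V] {A : V →L[ℝ] V} {μ : ℝ} (hμ : 0 < μ)
    (hA : ∀ v, inner ℝ (A v) v ≤ -μ * ‖v‖ ^ 2) : ‖A.inverse‖ ≤ 1 / μ := by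
  refine ContinuousLinearMap.opNorm_le_bound _ (by positivity) fun v => ?_
  have h := mul_norm_le_of_inner_le hA (A.inverse v)
  rw [(isInvertible_of_inner_le hμ hA).self_apply_inverse] at h
  rw [one_div, inv_mul_eq_div, le_div_iff₀ hμ]
  linarith

theorem inverse_sub_inverse {V : Type*} [NormedAddCommGroup V] [NormedSpace ℝ V]
    {A B : V →L[ℝ] V} (hA : A.IsInvertible) (hB : B.IsInvertible) :
    A.inverse - B.inverse = A.inverse ∘L (B - A) ∘L B.inverse := by
  ext v
  simp [hB.self_apply_inverse, hA.inverse_apply_self]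

/-- Perturbation bound for the Schur complement. -/
theorem norm_schur_sub_schur_le {A₁₁ B₁₁ : Vec m →L[ℝ] Vec m} {A₁₂ B₁₂ : Vec n →L[ℝ] Vec m}
    {A₂₁ B₂₁ : Vec m →L[ℝ] Vec n} {A₂₂ B₂₂ : Vec n →L[ℝ] Vec n} {L μ ε : ℝ} (hμ : 0 < μ)
    (hε : 0 ≤ ε) (hA₂₁ : ‖A₂₁‖ ≤ L) (hB₁₂ : ‖B₁₂‖ ≤ L)
    (hA₂₂ : ∀ v, inner ℝ (A₂₂ v) v ≤ -μ * ‖v‖ ^ 2)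
    (hB₂₂ : ∀ v, inner ℝ (B₂₂ v) v ≤ -μ * ‖v‖ ^ 2)
    (h₁₁ : ‖A₁₁ - B₁₁‖ ≤ ε) (h₁₂ : ‖A₁₂ - B₁₂‖ ≤ ε) (h₂₁ : ‖A₂₁ - B₂₁‖ ≤ ε)
    (h₂₂ : ‖A₂₂ - B₂₂‖ ≤ ε) :
    ‖schur A₁₁ A₁₂ A₂₁ A₂₂ - schur B₁₁ B₁₂ B₂₁ B₂₂‖ ≤ (L / μ + 1) ^ 2 * ε := by
  have hL : 0 ≤ L := (norm_nonneg _).trans hB₁₂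
  have hAi := norm_inverse_le_of_inner_le hμ hA₂₂
  have hBi := norm_inverse_le_of_inner_le hμ hB₂₂
  -- The three factors are replaced one at a time, in an order for which only `A₂₁` and `B₁₂` need
  -- norm bounds.
  have hdec : schur A₁₁ A₁₂ A₂₁ A₂₂ - schur B₁₁ B₁₂ B₂₁ B₂₂ =
      (A₁₁ - B₁₁) - (A₁₂ - B₁₂) ∘L A₂₂.inverse ∘L A₂₁ -
        B₁₂ ∘L (A₂₂.inverse ∘L (B₂₂ - A₂₂) ∘L B₂₂.inverse) ∘L A₂₁ -
        B₁₂ ∘L B₂₂.inverse ∘L (A₂₁ - B₂₁) := by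
    rw [← inverse_sub_inverse (isInvertible_of_inner_le hμ hA₂₂)
      (isInvertible_of_inner_le hμ hB₂₂)]
    ext1 v
    simp only [schur, _root_.sub_apply, ContinuousLinearMap.comp_apply, map_sub]
    abel
  have t1 : ‖(A₁₂ - B₁₂) ∘L A₂₂.inverse ∘L A₂₁‖ ≤ ε * (1 / μ * L) :=
    (ContinuousLinearMap.opNorm_comp_le _ _).trans <| by
      gcongr
      exact (ContinuousLinearMap.opNorm_comp_le _ _).trans (by gcongr)
  have t2 : ‖B₁₂ ∘L (A₂₂.inverse ∘L (B₂₂ - A₂₂) ∘L B₂₂.inverse) ∘L A₂₁‖ ≤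
      L * ((1 / μ * (ε * (1 / μ))) * L) := by
    rw [norm_sub_rev] at h₂₂
    refine (ContinuousLinearMap.opNorm_comp_le _ _).trans ?_
    gcongr
    refine (ContinuousLinearMap.opNorm_comp_le _ _).trans ?_
    gcongr
    refine (ContinuousLinearMap.opNorm_comp_le _ _).trans ?_
    gcongr
    exact (ContinuousLinearMap.opNorm_comp_le _ _).trans (by gcongr)
  have t3 : ‖B₁₂ ∘L B₂₂.inverse ∘L (A₂₁ - B₂₁)‖ ≤ L * (1 / μ * ε) :=
    (ContinuousLinearMap.opNorm_comp_le _ _).trans <| by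
      gcongr
      exact (ContinuousLinearMap.opNorm_comp_le _ _).trans (by gcongr)
  rw [hdec]
  calc _ ≤ ε + ε * (1 / μ * L) + L * ((1 / μ * (ε * (1 / μ))) * L) + L * (1 / μ * ε) :=
        norm_sub_le_of_le (norm_sub_le_of_le (norm_sub_le_of_le h₁₁ t1) t2) t3
    _ = _ := by ring

theorem norm_batchMean_le {V : Type*} [NormedAddCommGroup V] [NormedSpace ℝ V] {N b : ℕ}
    (β : Fin b → Fin N) {w : Fin N → V} {L : ℝ} (hL : 0 ≤ L) (hw : ∀ i, ‖w i‖ ≤ L) :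
    ‖batchMean β w‖ ≤ L := by
  rw [batchMean, norm_smul, Real.norm_of_nonneg (by positivity), one_div]
  refine inv_mul_le_of_le_mul₀ (by positivity) hL ((norm_sum_le _ _).trans ?_)
  exact (Finset.sum_le_sum fun k _ => hw (β k)).trans (by simp)

theorem inner_batchMean_le {V : Type*} [NormedAddCommGroup V] [InnerProductSpace ℝ V] {N b : ℕ}
    (hb : 0 < b) (β : Fin b → Fin N) {w : Fin N → V →L[ℝ] V} {μ : ℝ}
    (hw : ∀ i v, inner ℝ (w i v) v ≤ -μ * ‖v‖ ^ 2) (v : V) :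
    inner ℝ (batchMean β w v) v ≤ -μ * ‖v‖ ^ 2 := by
  have hb' : (0 : ℝ) < b := by exact_mod_cast hb
  simp only [batchMean, _root_.smul_apply, _root_.sum_apply,
    real_inner_smul_left, sum_inner]
  rw [one_div, inv_mul_le_iff₀ hb']
  exact (Finset.sum_le_sum fun k _ => hw (β k) v).trans (by simp)

/-- The full average is the batch mean along `id`. -/
theorem norm_inv_smul_sum_le {V : Type*} [NormedAddCommGroup V] [NormedSpace ℝ V] {N : ℕ}
    {w : Fin N → V} {L : ℝ} (hL : 0 ≤ L) (hw : ∀ i, ‖w i‖ ≤ L) :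
    ‖(1 / (N : ℝ)) • ∑ i, w i‖ ≤ L :=
  norm_batchMean_le id hL hw

theorem inner_inv_smul_sum_le {V : Type*} [NormedAddCommGroup V] [InnerProductSpace ℝ V] {N : ℕ}
    (hN : 0 < N) {w : Fin N → V →L[ℝ] V} {μ : ℝ}
    (hw : ∀ i v, inner ℝ (w i v) v ≤ -μ * ‖v‖ ^ 2) (v : V) :
    inner ℝ (((1 / (N : ℝ)) • ∑ i, w i) v) v ≤ -μ * ‖v‖ ^ 2 :=
  inner_batchMean_le hN id hw v

end Schur

end SubsampledMinimax

end

/-! ### Union bound and conclusion -/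

open SubsampledMinimax in
theorem lemma4 :
    ∃ C : ℝ, 0 < C ∧
      ∀ (m n N : ℕ) (f : Fin N → Vec m → Vec n → ℝ) (L₀ L₁ μ ε₁ ε₂ δ : ℝ)
        (x : Vec m) (y : Vec n)
        (Ω : Type*) [MeasurableSpace Ω] (P : Measure Ω) [IsProbabilityMeasure P]
        (b₁ b₁₁ b₁₂ b₂₁ b₂₂ : ℕ)
        (B₁ : Fin b₁ → Ω → Fin N) (B₁₁ : Fin b₁₁ → Ω → Fin N) (B₁₂ : Fin b₁₂ → Ω → Fin N)
        (B₂₁ : Fin b₂₁ → Ω → Fin N) (B₂₂ : Fin b₂₂ → Ω → Fin N),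
        0 < m → 0 < n → 0 < μ →
        (∀ i, SampleAssumption L₀ L₁ μ (f i)) →
        0 < ε₁ → ε₁ ≤ 2 * L₀ → 0 < ε₂ → ε₂ ≤ 4 * L₁ →
        0 < δ → δ < 1 → (2 ≤ m ∨ δ ≤ 1 / 2) →
        IsUniformBatch P B₁ → IsUniformBatch P B₁₁ → IsUniformBatch P B₁₂ →
        IsUniformBatch P B₂₁ → IsUniformBatch P B₂₂ →
        C * (L₀ ^ 2 / ε₁ ^ 2 * Real.log ((m : ℝ) / δ)) ≤ (b₁ : ℝ) →
        C * (L₁ ^ 2 / ε₂ ^ 2 * Real.log (((m : ℝ) + (n : ℝ)) / δ)) ≤ (b₁₁ : ℝ) →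
        C * (L₁ ^ 2 / ε₂ ^ 2 * Real.log (((m : ℝ) + (n : ℝ)) / δ)) ≤ (b₁₂ : ℝ) →
        C * (L₁ ^ 2 / ε₂ ^ 2 * Real.log (((m : ℝ) + (n : ℝ)) / δ)) ≤ (b₂₁ : ℝ) →
        C * (L₁ ^ 2 / ε₂ ^ 2 * Real.log (((m : ℝ) + (n : ℝ)) / δ)) ≤ (b₂₂ : ℝ) →
        (jac₂₂ (average f) x y).IsInvertible ∧
        1 - δ ≤ P.real {ω |
          let g := batchMean (fun k => B₁ k ω) (fun i => grad₁ (f i) x y)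
          let H₁₁ := batchMean (fun k => B₁₁ k ω) (fun i => jac₁₁ (f i) x y)
          let H₁₂ := batchMean (fun k => B₁₂ k ω) (fun i => jac₁₂ (f i) x y)
          let H₂₁ := batchMean (fun k => B₂₁ k ω) (fun i => jac₂₁ (f i) x y)
          let H₂₂ := batchMean (fun k => B₂₂ k ω) (fun i => jac₂₂ (f i) x y)
          ‖g - grad₁ (average f) x y‖ ≤ ε₁ ∧
          ‖H₁₁ - jac₁₁ (average f) x y‖ ≤ ε₂ ∧
          ‖H₁₂ - jac₁₂ (average f) x y‖ ≤ ε₂ ∧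
          ‖H₂₁ - jac₂₁ (average f) x y‖ ≤ ε₂ ∧
          ‖H₂₂ - jac₂₂ (average f) x y‖ ≤ ε₂ ∧
          H₂₂.IsInvertible ∧
          ‖schur H₁₁ H₁₂ H₂₁ H₂₂ - schurG (average f) x y‖ ≤ (L₁ / μ + 1) ^ 2 * ε₂} := by
  refine ⟨336, by norm_num, ?_⟩
  intro m n N f L₀ L₁ μ ε₁ ε₂ δ x y Ω _ P _ b₁ b₁₁ b₁₂ b₂₁ b₂₂ B₁ B₁₁ B₁₂ B₂₁ B₂₂
    hm hn hμ hf hε₁ hεL₁ hε₂ hεL₂ hδ hδ1 hmδ hB₁ hB₁₁ hB₁₂ hB₂₁ hB₂₂ hb₁ hb₁₁ hb₁₂ hb₂₁ hb₂₂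
  have hL₀ : 0 < L₀ := by linarith
  have hL₁ : 0 < L₁ := by linarith
  have hm1 : (1 : ℝ) ≤ m := by exact_mod_cast hm
  have hn1 : (1 : ℝ) ≤ n := by exact_mod_cast hn
  -- The alternative `2 ≤ m ∨ δ ≤ 1 / 2` keeps the logarithm at least `log 2`, so that it absorbs
  -- additive constants.
  have hD₁ : 2 ≤ (m : ℝ) / δ := by
    rw [le_div_iff₀ hδ]
    rcases hmδ with h | h
    · have : (2 : ℝ) ≤ m := by exact_mod_cast h
      linarith
    · linarith
  have hD : 2 ≤ ((m : ℝ) + n) / δ := by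
    rw [le_div_iff₀ hδ]
    linarith
  -- The size conditions force nonempty batches, so no batch mean takes the default value of `1 /
  -- 0`.
  have hpos : ∀ {L ε D : ℝ} {b : ℕ}, 0 < L → 0 < ε → 2 ≤ D →
      336 * (L ^ 2 / ε ^ 2 * Real.log D) ≤ b → 0 < b := by
    intro L ε D b hL hε hD hb
    have : 0 < Real.log D := Real.log_pos (by linarith)
    have : (0 : ℝ) < b := lt_of_lt_of_le (by positivity) hb
    exact_mod_cast this
  have hb₁' := hpos hL₀ hε₁ hD₁ hb₁
  have hb₁₁' := hpos hL₁ hε₂ hD hb₁₁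
  have hb₁₂' := hpos hL₁ hε₂ hD hb₁₂
  have hb₂₁' := hpos hL₁ hε₂ hD hb₂₁
  have hb₂₂' := hpos hL₁ hε₂ hD hb₂₂
  have hN : 0 < N := by
    obtain ⟨ω⟩ := P.nonempty_of_neZero
    exact Fin.pos (B₁ ⟨0, hb₁'⟩ ω)
  have hf2 := fun i => (hf i).twiceDifferentiable
  have hJ := fun i v => (hf i).inner_jac₂₂_le x y v
  have hJavg : ∀ v, inner ℝ (jac₂₂ (average f) x y v) v ≤ -μ * ‖v‖ ^ 2 := by
    rw [jac₂₂_average hf2]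
    exact inner_inv_smul_sum_le hN hJ
  have hJ₁₂avg : ‖jac₁₂ (average f) x y‖ ≤ L₁ := by
    rw [jac₁₂_average hf2]
    exact norm_inv_smul_sum_le hL₁.le fun i => (hf i).norm_jac₁₂_le hL₁.le x y
  refine ⟨isInvertible_of_inner_le hμ hJavg, ?_⟩
  -- The dimension condition here is `m + 1 ≤ 2m`; for each block the dimensions add up to at most
  -- `2(m + n)`.
  have e₁ := hB₁.measureReal_batchMean_vector_large_le hN hb₁' (fun i => grad₁ (f i) x y)
    (fun i => (hf i).norm_grad₁_le hL₀.le x y) hL₀ hε₁ hδ hD₁ (by simp; linarith) hb₁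
  rw [← grad₁_average hf2] at e₁
  have e₁₁ := hB₁₁.measureReal_batchMean_large_le hN hb₁₁' (fun i => jac₁₁ (f i) x y)
    (fun i => (hf i).norm_jac₁₁_le hL₁.le x y) hL₁ hε₂ hδ hD (by simp; linarith) hb₁₁
  have e₁₂ := hB₁₂.measureReal_batchMean_large_le hN hb₁₂' (fun i => jac₁₂ (f i) x y)
    (fun i => (hf i).norm_jac₁₂_le hL₁.le x y) hL₁ hε₂ hδ hD (by simp; linarith) hb₁₂
  have e₂₁ := hB₂₁.measureReal_batchMean_large_le hN hb₂₁' (fun i => jac₂₁ (f i) x y)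
    (fun i => (hf i).norm_jac₂₁_le hL₁.le x y) hL₁ hε₂ hδ hD (by simp; linarith) hb₂₁
  have e₂₂ := hB₂₂.measureReal_batchMean_large_le hN hb₂₂' (fun i => jac₂₂ (f i) x y)
    (fun i => (hf i).norm_jac₂₂_le hL₁.le x y) hL₁ hε₂ hδ hD (by simp; linarith) hb₂₂
  rw [← jac₁₁_average hf2] at e₁₁
  rw [← jac₁₂_average hf2] at e₁₂
  rw [← jac₂₁_average hf2] at e₂₁
  rw [← jac₂₂_average hf2] at e₂₂
  set s₁ := {ω | ε₁ < ‖batchMean (fun k => B₁ k ω) (fun i => grad₁ (f i) x y) -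
    grad₁ (average f) x y‖} with hs₁
  set s₁₁ := {ω | ε₂ < ‖batchMean (fun k => B₁₁ k ω) (fun i => jac₁₁ (f i) x y) -
    jac₁₁ (average f) x y‖} with hs₁₁
  set s₁₂ := {ω | ε₂ < ‖batchMean (fun k => B₁₂ k ω) (fun i => jac₁₂ (f i) x y) -
    jac₁₂ (average f) x y‖} with hs₁₂
  set s₂₁ := {ω | ε₂ < ‖batchMean (fun k => B₂₁ k ω) (fun i => jac₂₁ (f i) x y) -
    jac₂₁ (average f) x y‖} with hs₂₁
  set s₂₂ := {ω | ε₂ < ‖batchMean (fun k => B₂₂ k ω) (fun i => jac₂₂ (f i) x y) -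
    jac₂₂ (average f) x y‖} with hs₂₂
  set s := s₁ ∪ s₁₁ ∪ s₁₂ ∪ s₂₁ ∪ s₂₂ with hs
  have hmeas : MeasurableSet s :=
    ((((hB₁.measurableSet {β | ε₁ < ‖batchMean β (fun i => grad₁ (f i) x y) -
      grad₁ (average f) x y‖}).union
    (hB₁₁.measurableSet {β | ε₂ < ‖batchMean β (fun i => jac₁₁ (f i) x y) -
      jac₁₁ (average f) x y‖})).union
    (hB₁₂.measurableSet {β | ε₂ < ‖batchMean β (fun i => jac₁₂ (f i) x y) -
      jac₁₂ (average f) x y‖})).union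
    (hB₂₁.measurableSet {β | ε₂ < ‖batchMean β (fun i => jac₂₁ (f i) x y) -
      jac₂₁ (average f) x y‖})).union
    (hB₂₂.measurableSet {β | ε₂ < ‖batchMean β (fun i => jac₂₂ (f i) x y) -
      jac₂₂ (average f) x y‖})
  -- Five events of probability at most `δ / 5` each; the joint law of the batches plays no role.
  have hPs : P.real s ≤ δ := by
    have h1 := measureReal_union_le (μ := P) s₁ s₁₁
    have h2 := measureReal_union_le (μ := P) (s₁ ∪ s₁₁) s₁₂
    have h3 := measureReal_union_le (μ := P) (s₁ ∪ s₁₁ ∪ s₁₂) s₂₁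
    have h4 := measureReal_union_le (μ := P) (s₁ ∪ s₁₁ ∪ s₁₂ ∪ s₂₁) s₂₂
    linarith
  have hcompl : 1 - δ ≤ P.real sᶜ := by
    rw [probReal_compl_eq_one_sub hmeas]
    linarith
  refine hcompl.trans (measureReal_mono fun ω hω => ?_)
  simp only [hs, hs₁, hs₁₁, hs₁₂, hs₂₁, hs₂₂, Set.mem_compl_iff, Set.mem_union, Set.mem_ofPred_eq,
    not_or, not_lt] at hω
  obtain ⟨⟨⟨⟨h₁, h₁₁⟩, h₁₂⟩, h₂₁⟩, h₂₂⟩ := hω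
  -- This holds for every outcome, so invertibility of the sampled block costs no probability.
  have hJhat := inner_batchMean_le hb₂₂' (fun k => B₂₂ k ω) hJ
  exact ⟨h₁, h₁₁, h₁₂, h₂₁, h₂₂, isInvertible_of_inner_le hμ hJhat,
    norm_schur_sub_schur_le hμ hε₂.le
      (norm_batchMean_le _ hL₁.le fun i => (hf i).norm_jac₂₁_le hL₁.le x y)
      hJ₁₂avg hJhat hJavg h₁₁ h₁₂ h₂₁ h₂₂⟩
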